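/- Let $\mathcal W$ (parameters), $\mathcal X$ (observations) and $\hat{\mathcal W}$ (estimates) be measurable spaces, let $\mathcal P_W$ be a prior probability measure on $\mathcal W$, let $\mathcal P_{X|W}$ be a Markov kernel from $\mathcal W$ to $\mathcal X$, and let $\ell:\mathcal W\times\hat{\mathcal W}\to[0,\infty)$ be a measurable loss. Let $\mathcal P_{WX}$ be the joint law of $(W,X)$, with marginals $\mathcal P_W,\mathcal P_X$. For a measurable estimator $\phi:\mathcal X\to\hat{\mathcal W}$ put $\hat W=\phi(X)$. The Bayes risk is $R_B=\inf_{\phi}\mathbb E[\ell(W,\phi(X))]\in[0,\infty]$, the infimum being over all measurable $\phi:\mathcal X\to\hat{\mathcal W}$, and the small-ball probability is $L_W(\rho)=\sup_{\hat w\in\hat{\mathcal W}}\mathcal P_W(\ell(W,\hat w)<\rho)$. For $p>1$, the Hellinger $p$-mutual information of a pair $(U,V)$ with joint law $\mathcal P_{UV}$ is $\mathcal H_p(U,V)=D_{\varphi}(\mathcal P_{UV}\|\mathcal P_U\mathcal P_V)$ with $\varphi(x)=\frac{x^p-1}{p-1}$, where, for probability measures $P,Q$ with densities $f,g$ with respect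 to a dominating measure $\mu$, $D_\varphi(P\|Q)=\int g\,\varphi(f/g)\,d\mu\in(-\infty,\infty]$, with the usual convention $0\cdot\varphi(a/0)=a\lim_{t\to\infty}\varphi(t)/t$. (So $\mathcal H_p(U,V)=\infty$ unless $\mathcal P_{UV}\ll\mathcal P_U\mathcal P_V$.) Rényi's divergence of order $p$ is $D_p(P\|Q)=\frac1{p-1}\log\int f^p g^{1-p}\,d\mu$, where the integrand is $\infty$ on $\{g=0<f\}$ and $0$ on $\{f=0\}$. Let $p>1$ and $\rho>0$, and assume that $L_W(\rho)>0$ or $\mathcal P_{WX}\ll\mathcal P_W\mathcal P_X$. Then, with the convention $0\cdot\infty=0$ and with right-hand sides taking values in $[-\infty,\infty)$, $$R_B\ \ge\ \rho\left(1-L_W(\rho)^{\frac{p-1}{p}}\,\big((p-1)\,\mathcal H_p(W,X)+1\big)^{\frac1p}\right)$$ and, equivalently in terms of Rényi's divergence, $$R_B\ \ge\ \rho\left(1-L_W(\rho)^{\frac{p-1}{p}}\exp\left(\tfrac{p-1}{p}\,D_p(\mathcal P_{WX}\|\mathcal P_W\mathcal P_X)\right)\right).$$ Moreover, for every measurable estimator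 $\hat W=\phi(X)$, the expected loss $\mathbb E[\ell(W,\hat W)]$ is at least each of the two right-hand sides with $X$ replaced by $\hat W$, that is, at least $$\rho\left(1-L_W(\rho)^{\frac{p-1}{p}}\big((p-1)\mathcal H_p(W,\hat W)+1\big)^{\frac1p}\right)\quad\text{and}\quad\rho\left(1-L_W(\rho)^{\frac{p-1}{p}}\exp\left(\tfrac{p-1}{p}D_p(\mathcal P_{W\hat W}\|\mathcal P_W\mathcal P_{\hat W})\right)\right).$$ -/

import Mathlib

open MeasureTheory ProbabilityTheory Filter
open scoped ENNReal NNReal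

namespace BayesLower

noncomputable section

/-! ### Information measures -/

/-- The slope at infinity `lim_{t → ∞} φ(t) / t` of a function `φ` on `[0, ∞)`. For a convex `φ` the
limit exists in `(-∞, +∞]`, and the upper limit below is that limit. -/
def slopeAtTop (φ : ℝ → ℝ) : EReal :=
  limsup (fun t : ℝ => ((φ t / t : ℝ) : EReal)) atTop

/-- The `φ`-divergence `D_φ(P‖Q) = ∫ q φ(p / q) dμ` of two probability measures, for `φ` convex on
`[0, ∞)`, where `p`, `q` are the densities with respect to any dominating measure `μ`, with the usual
convention `0 φ(p / 0) = p * lim_{t → ∞} φ(t) / t`.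

The part of the integral over `{q > 0}` is `∫ φ(dP/dQ) dQ`. A convex `φ` has an affine minorant, so
the negative part of the integrand is integrable, and the integral is `+∞` when the integrand is not
integrable. The part over `{q = 0}` is the slope at infinity times the mass of the singular part of
`P`; it vanishes when `P ≪ Q`. -/
def phiDiv {Ω : Type*} [MeasurableSpace Ω] (φ : ℝ → ℝ) (P Q : Measure Ω) : EReal :=
  open Classical in
  (if Integrable (fun x => φ (P.rnDeriv Q x).toReal) Q
    then ((∫ x, φ (P.rnDeriv Q x).toReal ∂Q : ℝ) : EReal) else ⊤)
  + slopeAtTop φ * ((P.singularPart Q Set.univ : ℝ≥0∞) : EReal)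

/-- The `φ`-mutual information `I_φ(X, Y) = D_φ(P_{XY}‖P_X P_Y)` of a pair with joint law `P_{XY}`. -/
def phiMutualInfo {A B : Type*} [MeasurableSpace A] [MeasurableSpace B]
    (φ : ℝ → ℝ) (PXY : Measure (A × B)) : EReal :=
  phiDiv φ PXY (PXY.fst.prod PXY.snd)

/-- The function `x ↦ (x ^ p - 1) / (p - 1)`, which generates the Hellinger `p`-divergence. -/
def hellingerFun (p : ℝ) (x : ℝ) : ℝ := (x ^ p - 1) / (p - 1)

/-- The Hellinger `p`-mutual information `H_p(X, Y)` of a pair with joint law `P_{XY}`. -/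
def hellingerInfo {A B : Type*} [MeasurableSpace A] [MeasurableSpace B]
    (p : ℝ) (PXY : Measure (A × B)) : EReal :=
  phiMutualInfo (hellingerFun p) PXY

/-- Rényi's `α`-divergence `D_α(P‖Q) = 1 / (α - 1) * log ∫ p ^ α q ^ (1 - α) dμ`, with the densities
`p`, `q` taken with respect to `μ = P + Q`. For `α > 1` the arithmetic of `[0, ∞]` makes the integrand
`∞` where `q = 0 < p`. -/
def renyiDiv {Ω : Type*} [MeasurableSpace Ω] (α : ℝ) (P Q : Measure Ω) : EReal :=
  ((1 / (α - 1) : ℝ) : EReal) *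
    ENNReal.log (∫⁻ x, (P.rnDeriv (P + Q) x) ^ α * (Q.rnDeriv (P + Q) x) ^ (1 - α) ∂(P + Q))

/-- Rényi's divergence `D_α(P_{XY}‖P_X P_Y)` for a pair with joint law `P_{XY}`. -/
def renyiInfo {A B : Type*} [MeasurableSpace A] [MeasurableSpace B]
    (α : ℝ) (PXY : Measure (A × B)) : EReal :=
  renyiDiv α PXY (PXY.fst.prod PXY.snd)

/-! ### The Bayesian framework -/

section Framework

variable {𝓦 𝓧 𝓥 : Type*} [MeasurableSpace 𝓦] [MeasurableSpace 𝓧] [MeasurableSpace 𝓥]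

/-- The joint law of the parameter `W ∼ P_W` and the observation `X ∼ P_{X|W}`. -/
def jointLaw (PW : Measure 𝓦) (κ : Kernel 𝓦 𝓧) : Measure (𝓦 × 𝓧) := PW ⊗ₘ κ

/-- The joint law of `(W, φ(X))` for the estimator `φ`. -/
def estimatorLaw (PW : Measure 𝓦) (κ : Kernel 𝓦 𝓧) (φ : 𝓧 → 𝓥) : Measure (𝓦 × 𝓥) :=
  (jointLaw PW κ).map (fun z => (z.1, φ z.2))

/-- The expected loss of the estimator `φ`. -/
def estimatorRisk (PW : Measure 𝓦) (κ : Kernel 𝓦 𝓧) (ℓ : 𝓦 × 𝓥 → ℝ≥0) (φ : 𝓧 → 𝓥) : ℝ≥0∞ :=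
  ∫⁻ z, (ℓ (z.1, φ z.2) : ℝ≥0∞) ∂(jointLaw PW κ)

/-- The Bayes risk `R_B`: the infimum of the expected loss over all (measurable) estimators
`φ : 𝓧 → 𝓥`. Estimators are functions of the observation, not randomised ones. -/
def bayesRiskDet (PW : Measure 𝓦) (κ : Kernel 𝓦 𝓧) (ℓ : 𝓦 × 𝓥 → ℝ≥0) : ℝ≥0∞ :=
  ⨅ (φ : 𝓧 → 𝓥) (_ : Measurable φ), estimatorRisk PW κ ℓ φ

/-- The small-ball probability `L_W(ρ) = sup_v P_W(ℓ(W, v) < ρ)`. -/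
def smallBall (PW : Measure 𝓦) (ℓ : 𝓦 × 𝓥 → ℝ≥0) (ρ : ℝ) : ℝ≥0∞ :=
  ⨆ v : 𝓥, PW {w | (ℓ (w, v) : ℝ) < ρ}

end Framework

/-- The value `ρ (1 - L ^ ((p - 1) / p) * ((p - 1) H + 1) ^ (1 / p))`, in `[-∞, ∞)`, where `L` is a
probability and `H` the Hellinger `p`-mutual information. The quantity `(p - 1) H + 1` is nonnegative,
being `∫ (dP/dQ) ^ p dQ` or `∞`. The product of `0` and `∞` is `0`. -/
def hellingerBound (p ρ : ℝ) (L : ℝ≥0∞) (H : EReal) : EReal :=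
  (ρ : EReal) * (1 - ((L ^ ((p - 1) / p) *
    ((((p - 1 : ℝ) : EReal) * H + 1).toENNReal) ^ (1 / p) : ℝ≥0∞) : EReal))

/-- The value `ρ (1 - L ^ ((α - 1) / α) * exp ((α - 1) / α * D))`, in `[-∞, ∞)`. The product of `0`
and `∞` is `0`. -/
def renyiBound (α ρ : ℝ) (L : ℝ≥0∞) (D : EReal) : EReal :=
  (ρ : EReal) * (1 - ((L ^ ((α - 1) / α) *
    EReal.exp ((((α - 1) / α : ℝ) : EReal) * D) : ℝ≥0∞) : EReal))

end

end BayesLower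

namespace BayesLower

/-! ### Hölder's inequality for measures with densities -/

section Holder

variable {Ω : Type*} [MeasurableSpace Ω]

/-! Let `E` be the event that the loss of an estimator is below `ρ`. Markov's inequality bounds the
risk below by `ρ (1 - P E)`, with `P` the joint law (`mul_one_sub_le_lintegral`). Under the product
`Q` of the marginals the estimate is independent of `W`, so `Q E` is at most the small-ball
probability (`prod_lt_le_smallBall`). Hölder's inequality transfers this to `P`: `P E ≤ Q E ^ ((p -
1) / p) * (∫ f ^ p g ^ (1 - p) dμ) ^ (1 / p)` when `P ≪ Q` (`withDensity_apply_le_rpow_mul_rpow`),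
and both divergences encode that integral. If `P` is not absolutely continuous, both are infinite
and `L ≠ 0` makes the bounds trivial. -/

lemma ae_density_eq_zero_of_absolutelyContinuous {μ : Measure Ω} {f g : Ω → ℝ≥0∞}
    (hf : Measurable f) (hg : Measurable g) (hac : μ.withDensity f ≪ μ.withDensity g) :
    ∀ᵐ x ∂μ, g x = 0 → f x = 0 := by
  have hs : MeasurableSet {x | g x = 0} := hg (measurableSet_singleton 0)
  have h0 : μ.withDensity g {x | g x = 0} = 0 := by
    rw [withDensity_apply _ hs, setLIntegral_eq_zero_iff hs hg]
    exact ae_of_all _ fun x hx => hx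
  have h1 := hac h0
  rw [withDensity_apply _ hs, setLIntegral_eq_zero_iff hs hf] at h1
  exact h1

lemma absolutelyContinuous_withDensity_of_ae {μ : Measure Ω} {f g : Ω → ℝ≥0∞}
    (hf : Measurable f) (hg : Measurable g) (h : ∀ᵐ x ∂μ, g x = 0 → f x = 0) :
    μ.withDensity f ≪ μ.withDensity g := by
  refine Measure.AbsolutelyContinuous.mk fun s hs hs0 => ?_
  rw [withDensity_apply _ hs, setLIntegral_eq_zero_iff hs hg] at hs0
  rw [withDensity_apply _ hs, setLIntegral_eq_zero_iff hs hf]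
  filter_upwards [h, hs0] with x hx hx0 hxs using hx (hx0 hxs)

lemma absolutelyContinuous_of_lintegral_rpow_ne_top {μ : Measure Ω} {f g : Ω → ℝ≥0∞}
    (hf : Measurable f) (hg : Measurable g) {p : ℝ} (hp : 1 < p)
    (h : ∫⁻ x, f x ^ p * g x ^ (1 - p) ∂μ ≠ ∞) : μ.withDensity f ≪ μ.withDensity g := by
  refine absolutelyContinuous_withDensity_of_ae hf hg ?_
  filter_upwards [ae_lt_top (by fun_prop) h] with x hx hgx
  by_contra hfx
  rw [hgx, ENNReal.zero_rpow_of_neg (by linarith), ENNReal.mul_top] at hx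
  · exact lt_irrefl _ hx
  · simp [ENNReal.rpow_eq_zero_iff, hfx]
    intro _
    linarith

/-- Hölder with exponents `p` and `p / (p - 1)` for `f = (f g ^ ((1 - p) / p)) * g ^ ((p - 1) / p)`
on `E`. Absolute continuity is what saves this factorization where `g = 0`. The dominating measure
is left free, to cover both `Q` and `P + Q`. -/
lemma withDensity_apply_le_rpow_mul_rpow {μ : Measure Ω} {f g : Ω → ℝ≥0∞}
    (hf : Measurable f) (hg : Measurable g) (hg_top : ∀ᵐ x ∂μ, g x ≠ ∞) {p : ℝ} (hp : 1 < p)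
    (hac : μ.withDensity f ≪ μ.withDensity g) {E : Set Ω} (hE : MeasurableSet E) :
    μ.withDensity f E ≤ μ.withDensity g E ^ ((p - 1) / p) *
      (∫⁻ x, f x ^ p * g x ^ (1 - p) ∂μ) ^ (1 / p) := by
  have hp0 : 0 < p := by linarith
  have hpq : p.HolderConjugate (p / (p - 1)) := Real.HolderConjugate.conjExponent hp
  have hpoint : ∀ᵐ x ∂μ.restrict E,
      f x ≤ ((fun x => f x * g x ^ ((1 - p) / p)) * fun x => g x ^ ((p - 1) / p)) x := by
    refine ae_restrict_of_ae ?_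
    filter_upwards [ae_density_eq_zero_of_absolutelyContinuous hf hg hac, hg_top] with x hx hxt
    by_cases hgx : g x = 0
    · simp [hx hgx]
    · rw [Pi.mul_apply, mul_assoc, ← ENNReal.rpow_add _ _ hgx hxt, ← add_div]
      simp
  rw [withDensity_apply _ hE, withDensity_apply _ hE, mul_comm]
  calc ∫⁻ x in E, f x ∂μ
      ≤ ∫⁻ x in E, ((fun x => f x * g x ^ ((1 - p) / p)) * fun x => g x ^ ((p - 1) / p)) x ∂μ :=
        lintegral_mono_ae hpoint
    _ ≤ _ := ENNReal.lintegral_mul_le_Lp_mul_Lq _ hpq (by fun_prop) (by fun_prop)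
    _ = (∫⁻ x in E, f x ^ p * g x ^ (1 - p) ∂μ) ^ (1 / p) *
          (∫⁻ x in E, g x ∂μ) ^ ((p - 1) / p) := by
        have h1 : (1 - p) / p * p = 1 - p := by field_simp
        have h2 : (p - 1) / p * (p / (p - 1)) = 1 := by
          have : p - 1 ≠ 0 := by linarith
          field_simp
        simp_rw [ENNReal.mul_rpow_of_nonneg _ _ hp0.le, ← ENNReal.rpow_mul, h1, h2,
          ENNReal.rpow_one, one_div_div]
    _ ≤ _ := by
        gcongr
        exact Measure.restrict_le_self

/-! ### The divergences bound the probability of an event -/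

lemma slopeAtTop_hellingerFun {p : ℝ} (hp : 1 < p) : slopeAtTop (hellingerFun p) = ⊤ := by
  refine Tendsto.limsup_eq (EReal.tendsto_coe_nhds_top_iff.2 ?_)
  -- For `t ≥ 1`, `1 / t ≤ 1` makes this a minorant of `φ(t) / t = (t ^ (p - 1) - 1 / t) / (p - 1)`.
  have h : Tendsto (fun t : ℝ => (t ^ (p - 1) - 1) / (p - 1)) atTop atTop :=
    (tendsto_atTop_add_const_right _ (-1)
      (tendsto_rpow_atTop (sub_pos.2 hp))).atTop_div_const (sub_pos.2 hp)
  refine tendsto_atTop_mono' _ ?_ h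
  filter_upwards [eventually_ge_atTop 1] with t ht
  have ht0 : 0 < t := by linarith
  rw [hellingerFun, div_right_comm, sub_div _ _ t, ← Real.rpow_sub_one ht0.ne']
  have h1 : 1 / t ≤ 1 := (div_le_one ht0).2 ht
  have hp1 : 0 < p - 1 := by linarith
  gcongr

lemma exp_mul_renyiDiv (P Q : Measure Ω) {p : ℝ} (hp : 1 < p) :
    EReal.exp ((((p - 1) / p : ℝ) : EReal) * renyiDiv p P Q) =
      (∫⁻ x, P.rnDeriv (P + Q) x ^ p * Q.rnDeriv (P + Q) x ^ (1 - p) ∂(P + Q)) ^ (1 / p) := by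
  have hp1 : p - 1 ≠ 0 := by linarith
  rw [renyiDiv, ← mul_assoc, ← EReal.coe_mul]
  have : (p - 1) / p * (1 / (p - 1)) = 1 / p := by field_simp
  rw [this, ← ENNReal.log_rpow, ENNReal.exp_log]

variable {P Q : Measure Ω} [IsProbabilityMeasure P] [IsProbabilityMeasure Q]

lemma phiDiv_hellingerFun_of_not_absolutelyContinuous {p : ℝ} (hp : 1 < p) (hac : ¬ P ≪ Q) :
    phiDiv (hellingerFun p) P Q = ⊤ := by
  have hne : P.singularPart Q Set.univ ≠ 0 := by
    rwa [Ne, Measure.measure_univ_eq_zero, Measure.singularPart_eq_zero]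
  have hpos : (0 : EReal) < ((P.singularPart Q Set.univ : ℝ≥0∞) : EReal) := by
    simpa [pos_iff_ne_zero] using hne
  rw [phiDiv, slopeAtTop_hellingerFun hp, EReal.top_mul_of_pos hpos]
  split_ifs
  · exact EReal.coe_add_top _
  · rfl

lemma lintegral_rnDeriv_rpow_le_phiDiv {p : ℝ} (hp : 1 < p) (hac : P ≪ Q) :
    ∫⁻ x, P.rnDeriv Q x ^ p ∂Q ≤
      (((p - 1 : ℝ) : EReal) * phiDiv (hellingerFun p) P Q + 1).toENNReal := by
  have hp1 : 0 < p - 1 := by linarith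
  have hp0 : 0 ≤ p := by linarith
  have hsing : P.singularPart Q = 0 := (Measure.singularPart_eq_zero P Q).2 hac
  rw [phiDiv, hsing]
  simp only [Measure.coe_zero, Pi.zero_apply, EReal.coe_ennreal_zero, mul_zero, add_zero]
  split_ifs with hint
  · have hpow : Integrable (fun x => (P.rnDeriv Q x).toReal ^ p) Q := by
      have := (hint.const_mul (p - 1)).add (integrable_const (1 : ℝ))
      refine this.congr (ae_of_all _ fun x => ?_)
      simp only [hellingerFun, Pi.add_apply]
      field_simp
      ring
    have hval : (p - 1) * ∫ x, hellingerFun p (P.rnDeriv Q x).toReal ∂Q + 1 =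
        ∫ x, (P.rnDeriv Q x).toReal ^ p ∂Q := by
      simp only [hellingerFun]
      rw [integral_div, integral_sub hpow (integrable_const _)]
      simp
      field_simp
      ring
    have hcoe : (((p - 1 : ℝ) : EReal) *
        ((∫ x, hellingerFun p (P.rnDeriv Q x).toReal ∂Q : ℝ) : EReal) + 1) =
        ((∫ x, (P.rnDeriv Q x).toReal ^ p ∂Q : ℝ) : EReal) := by
      rw [← hval]
      push_cast
      rfl
    rw [hcoe, EReal.toENNReal_of_ne_top (EReal.coe_ne_top _), EReal.toReal_coe,
      ofReal_integral_eq_lintegral_ofReal hpow (ae_of_all _ fun x => by positivity)]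
    refine (lintegral_congr_ae ?_).le
    filter_upwards [P.rnDeriv_ne_top Q] with x hx
    rw [← ENNReal.ofReal_rpow_of_nonneg ENNReal.toReal_nonneg hp0, ENNReal.ofReal_toReal hx]
  · rw [EReal.coe_mul_top_of_pos hp1]
    exact le_top

/-- The hypothesis `h` excludes the product `0 * ∞ = 0`, which would assert `P E = 0` for a `P` that
is not absolutely continuous. -/
lemma measure_le_rpow_mul_phiDiv {p : ℝ} (hp : 1 < p) {L : ℝ≥0∞} (h : L ≠ 0 ∨ P ≪ Q)
    {E : Set Ω} (hE : MeasurableSet E) (hQE : Q E ≤ L) :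
    P E ≤ L ^ ((p - 1) / p) *
      ((((p - 1 : ℝ) : EReal) * phiDiv (hellingerFun p) P Q + 1).toENNReal) ^ (1 / p) := by
  have hp0 : 0 < p := by linarith
  have hp1 : 0 < p - 1 := by linarith
  by_cases hac : P ≪ Q
  · have hP : Q.withDensity (P.rnDeriv Q) = P := Measure.withDensity_rnDeriv_eq P Q hac
    have key := withDensity_apply_le_rpow_mul_rpow (μ := Q) (P.measurable_rnDeriv Q)
      (g := 1) measurable_one (ae_of_all _ fun _ => ENNReal.one_ne_top) hp
      (by rwa [hP, withDensity_one]) hE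
    simp only [hP, withDensity_one, Pi.one_apply, ENNReal.one_rpow, mul_one] at key
    refine key.trans ?_
    gcongr
    exact lintegral_rnDeriv_rpow_le_phiDiv hp hac
  · have hL := h.resolve_right hac
    rw [phiDiv_hellingerFun_of_not_absolutelyContinuous hp hac, EReal.coe_mul_top_of_pos hp1]
    have : ((⊤ : EReal) + 1).toENNReal = ⊤ := rfl
    rw [this, ENNReal.top_rpow_of_pos (by positivity), ENNReal.mul_top]
    · exact le_top
    · simp only [Ne, ENNReal.rpow_eq_zero_iff, hL, false_and, false_or, not_and, not_lt]
      intro _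
      positivity

lemma measure_le_rpow_mul_renyiDiv {p : ℝ} (hp : 1 < p) {L : ℝ≥0∞} (h : L ≠ 0 ∨ P ≪ Q)
    {E : Set Ω} (hE : MeasurableSet E) (hQE : Q E ≤ L) :
    P E ≤ L ^ ((p - 1) / p) * EReal.exp ((((p - 1) / p : ℝ) : EReal) * renyiDiv p P Q) := by
  have hp0 : 0 < p := by linarith
  have hp1 : 0 < p - 1 := by linarith
  rw [exp_mul_renyiDiv P Q hp]
  have hP : (P + Q).withDensity (P.rnDeriv (P + Q)) = P :=
    Measure.withDensity_rnDeriv_eq P _ (Measure.le_add_right le_rfl).absolutelyContinuous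
  have hQ : (P + Q).withDensity (Q.rnDeriv (P + Q)) = Q :=
    Measure.withDensity_rnDeriv_eq Q _ (Measure.le_add_left le_rfl).absolutelyContinuous
  by_cases hac : P ≪ Q
  · have key := withDensity_apply_le_rpow_mul_rpow (μ := P + Q) (P.measurable_rnDeriv (P + Q))
      (Q.measurable_rnDeriv (P + Q)) (Q.rnDeriv_ne_top (P + Q)) hp (by rwa [hP, hQ]) hE
    rw [hP, hQ] at key
    refine key.trans ?_
    gcongr
  · have hL := h.resolve_right hac
    have htop : ∫⁻ x, P.rnDeriv (P + Q) x ^ p * Q.rnDeriv (P + Q) x ^ (1 - p) ∂(P + Q) = ∞ := by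
      by_contra hne
      have := absolutelyContinuous_of_lintegral_rpow_ne_top (P.measurable_rnDeriv (P + Q))
        (Q.measurable_rnDeriv (P + Q)) hp hne
      rw [hP, hQ] at this
      exact hac this
    rw [htop, ENNReal.top_rpow_of_pos (by positivity), ENNReal.mul_top]
    · exact le_top
    · simp only [Ne, ENNReal.rpow_eq_zero_iff, hL, false_and, false_or, not_and, not_lt]
      intro _
      positivity

/-- Markov's inequality, for an event on whose complement the loss is at least `ρ`. -/
lemma mul_one_sub_le_lintegral {ρ : ℝ} (hρ : 0 < ρ) {f : Ω → ℝ≥0} (hf : Measurable f)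
    {K : ℝ≥0∞} (hK : P {x | (f x : ℝ) < ρ} ≤ K) :
    (ρ : EReal) * (1 - (K : EReal)) ≤ ((∫⁻ x, (f x : ℝ≥0∞) ∂P : ℝ≥0∞) : EReal) := by
  have hE : MeasurableSet {x | (f x : ℝ) < ρ} :=
    measurableSet_lt (by fun_prop) measurable_const
  have hcompl : {x | (f x : ℝ) < ρ}ᶜ = {x | ENNReal.ofReal ρ ≤ (f x : ℝ≥0∞)} := by
    ext x
    simp [ENNReal.ofReal, Real.toNNReal_le_iff_le_coe]
  have hmarkov : ENNReal.ofReal ρ * (1 - K) ≤ ∫⁻ x, (f x : ℝ≥0∞) ∂P := by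
    refine le_trans ?_ (mul_meas_ge_le_lintegral (by fun_prop) (ENNReal.ofReal ρ))
    rw [← hcompl, prob_compl_eq_one_sub hE]
    gcongr
  -- Subtraction in `ℝ≥0∞` truncates at `0`, so it dominates the possibly negative `1 - K` in
  -- `EReal`.
  refine le_trans ?_ (EReal.coe_ennreal_le_coe_ennreal_iff.2 hmarkov)
  rw [EReal.coe_ennreal_mul, EReal.coe_ennreal_ofReal, max_eq_left hρ.le]
  refine mul_le_mul_of_nonneg_left ?_ (EReal.coe_nonneg.2 hρ.le)
  rw [EReal.sub_le_iff_le_add (Or.inl (EReal.coe_ennreal_ne_bot _)) (Or.inr (by simp))]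
  rw [← EReal.coe_ennreal_add, ← EReal.coe_ennreal_one, EReal.coe_ennreal_le_coe_ennreal_iff]
  exact le_tsub_add

end Holder

/-! ### Bounds on the expected loss -/

section Risk

variable {𝓦 𝓧 𝓥 : Type*} [MeasurableSpace 𝓦] [MeasurableSpace 𝓧] [MeasurableSpace 𝓥]

lemma prod_lt_le_smallBall (PW : Measure 𝓦) [IsProbabilityMeasure PW] (PX : Measure 𝓧)
    [IsProbabilityMeasure PX] {ℓ : 𝓦 × 𝓥 → ℝ≥0} (hℓ : Measurable ℓ) (ρ : ℝ) {ψ : 𝓧 → 𝓥}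
    (hψ : Measurable ψ) :
    PW.prod PX {z | (ℓ (z.1, ψ z.2) : ℝ) < ρ} ≤ smallBall PW ℓ ρ := by
  have hE : MeasurableSet {z : 𝓦 × 𝓧 | (ℓ (z.1, ψ z.2) : ℝ) < ρ} :=
    measurableSet_lt (by fun_prop) measurable_const
  rw [Measure.prod_apply_symm hE]
  calc _ ≤ ∫⁻ _, smallBall PW ℓ ρ ∂PX :=
        lintegral_mono fun y => le_iSup (fun v => PW {w | (ℓ (w, v) : ℝ) < ρ}) (ψ y)
    _ = smallBall PW ℓ ρ := by simp

/-- Keeping `P` general lets this serve twice: for the law of `(W, X)` with an estimator `ψ`, and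
for the law of `(W, φ(X))` with `ψ = id`. -/
lemma bounds_le_lintegral {PW : Measure 𝓦} [IsProbabilityMeasure PW] {P : Measure (𝓦 × 𝓧)}
    [IsProbabilityMeasure P] (hfst : P.fst = PW) {ℓ : 𝓦 × 𝓥 → ℝ≥0} (hℓ : Measurable ℓ)
    {p ρ : ℝ} (hp : 1 < p) (hρ : 0 < ρ)
    (h : smallBall PW ℓ ρ ≠ 0 ∨ P ≪ P.fst.prod P.snd) {ψ : 𝓧 → 𝓥} (hψ : Measurable ψ) :
    hellingerBound p ρ (smallBall PW ℓ ρ) (hellingerInfo p P) ≤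
        ((∫⁻ z, (ℓ (z.1, ψ z.2) : ℝ≥0∞) ∂P : ℝ≥0∞) : EReal) ∧
      renyiBound p ρ (smallBall PW ℓ ρ) (renyiInfo p P) ≤
        ((∫⁻ z, (ℓ (z.1, ψ z.2) : ℝ≥0∞) ∂P : ℝ≥0∞) : EReal) := by
  have hE : MeasurableSet {z : 𝓦 × 𝓧 | (ℓ (z.1, ψ z.2) : ℝ) < ρ} :=
    measurableSet_lt (by fun_prop) measurable_const
  have hQ : P.fst.prod P.snd {z | (ℓ (z.1, ψ z.2) : ℝ) < ρ} ≤ smallBall PW ℓ ρ := by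
    rw [hfst]
    exact prod_lt_le_smallBall PW P.snd hℓ ρ hψ
  have hm : Measurable fun z : 𝓦 × 𝓧 => ℓ (z.1, ψ z.2) := by fun_prop
  exact ⟨mul_one_sub_le_lintegral hρ hm (measure_le_rpow_mul_phiDiv hp h hE hQ),
    mul_one_sub_le_lintegral hρ hm (measure_le_rpow_mul_renyiDiv hp h hE hQ)⟩

lemma le_coe_bayesRiskDet {PW : Measure 𝓦} {κ : Kernel 𝓦 𝓧} {ℓ : 𝓦 × 𝓥 → ℝ≥0} {b : EReal}
    (h : ∀ φ : 𝓧 → 𝓥, Measurable φ → b ≤ (estimatorRisk PW κ ℓ φ : EReal)) :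
    b ≤ (bayesRiskDet PW κ ℓ : EReal) := by
  -- The infimum lives in `ℝ≥0∞` and `b` may be negative, so `b` is replaced by its positive part.
  have : b.toENNReal ≤ bayesRiskDet PW κ ℓ := le_iInf₂ fun φ hφ => by
    simpa using EReal.toENNReal_le_toENNReal (h φ hφ)
  refine le_trans ?_ (EReal.coe_ennreal_le_coe_ennreal_iff.2 this)
  rw [EReal.coe_toENNReal_eq_max]
  exact le_max_right _ _

lemma snd_estimatorLaw (PW : Measure 𝓦) (κ : Kernel 𝓦 𝓧) {φ : 𝓧 → 𝓥}
    (hφ : Measurable φ) :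
    (estimatorLaw PW κ φ).snd = (jointLaw PW κ).snd.map φ := by
  rw [estimatorLaw, Measure.snd_map_prodMk (by fun_prop), Measure.snd,
    Measure.map_map hφ measurable_snd]
  rfl

lemma lintegral_estimatorLaw (PW : Measure 𝓦) (κ : Kernel 𝓦 𝓧)
    {ℓ : 𝓦 × 𝓥 → ℝ≥0} (hℓ : Measurable ℓ) {φ : 𝓧 → 𝓥} (hφ : Measurable φ) :
    ∫⁻ z, (ℓ (z.1, id z.2) : ℝ≥0∞) ∂(estimatorLaw PW κ φ) = estimatorRisk PW κ ℓ φ := by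
  rw [estimatorLaw, lintegral_map (by fun_prop) (by fun_prop)]
  rfl

variable (PW : Measure 𝓦) [IsProbabilityMeasure PW] (κ : Kernel 𝓦 𝓧) [IsMarkovKernel κ]

instance : IsProbabilityMeasure (jointLaw PW κ) := by
  unfold jointLaw
  infer_instance

lemma isProbabilityMeasure_estimatorLaw {φ : 𝓧 → 𝓥} (hφ : Measurable φ) :
    IsProbabilityMeasure (estimatorLaw PW κ φ) :=
  Measure.isProbabilityMeasure_map (by fun_prop)

lemma fst_jointLaw : (jointLaw PW κ).fst = PW := Measure.fst_compProd PW κ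

lemma fst_estimatorLaw {φ : 𝓧 → 𝓥} (hφ : Measurable φ) : (estimatorLaw PW κ φ).fst = PW := by
  rw [estimatorLaw, Measure.fst_map_prodMk (by fun_prop)]
  exact fst_jointLaw PW κ

/-- Pushing forward along `id × φ` preserves `≪` and takes the product of the marginals to the
product of the new marginals. -/
lemma estimatorLaw_absolutelyContinuous {φ : 𝓧 → 𝓥} (hφ : Measurable φ)
    (h : jointLaw PW κ ≪ (jointLaw PW κ).fst.prod (jointLaw PW κ).snd) :
    estimatorLaw PW κ φ ≪ (estimatorLaw PW κ φ).fst.prod (estimatorLaw PW κ φ).snd := by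
  have := h.map (f := Prod.map id φ) (by fun_prop)
  rw [← Measure.map_prod_map _ _ measurable_id hφ, Measure.map_id, fst_jointLaw,
    ← snd_estimatorLaw PW κ hφ] at this
  rw [fst_estimatorLaw PW κ hφ]
  exact this

end Risk

end BayesLower

theorem mainTheorem3
    {𝓦 𝓧 𝓥 : Type*} [MeasurableSpace 𝓦] [MeasurableSpace 𝓧] [MeasurableSpace 𝓥]
    (PW : Measure 𝓦) [IsProbabilityMeasure PW]
    (κ : Kernel 𝓦 𝓧) [IsMarkovKernel κ]
    (ℓ : 𝓦 × 𝓥 → ℝ≥0) (hℓ : Measurable ℓ)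
    (p ρ : ℝ) (hp : 1 < p) (hρ : 0 < ρ)
    (h : BayesLower.smallBall PW ℓ ρ ≠ 0 ∨
      BayesLower.jointLaw PW κ ≪
        (BayesLower.jointLaw PW κ).fst.prod (BayesLower.jointLaw PW κ).snd) :
    -- the bound on the Bayes risk through the Hellinger information
    (BayesLower.hellingerBound p ρ (BayesLower.smallBall PW ℓ ρ)
        (BayesLower.hellingerInfo p (BayesLower.jointLaw PW κ))
      ≤ (BayesLower.bayesRiskDet PW κ ℓ : EReal)) ∧
    -- the same bound through Rényi's divergence
    (BayesLower.renyiBound p ρ (BayesLower.smallBall PW ℓ ρ)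
        (BayesLower.renyiInfo p (BayesLower.jointLaw PW κ))
      ≤ (BayesLower.bayesRiskDet PW κ ℓ : EReal)) ∧
    -- the two bounds for a fixed estimator
    (∀ φ : 𝓧 → 𝓥, Measurable φ →
      BayesLower.hellingerBound p ρ (BayesLower.smallBall PW ℓ ρ)
          (BayesLower.hellingerInfo p (BayesLower.estimatorLaw PW κ φ))
        ≤ (BayesLower.estimatorRisk PW κ ℓ φ : EReal) ∧
      BayesLower.renyiBound p ρ (BayesLower.smallBall PW ℓ ρ)
          (BayesLower.renyiInfo p (BayesLower.estimatorLaw PW κ φ))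
        ≤ (BayesLower.estimatorRisk PW κ ℓ φ : EReal)) := by
  have hjoint := fun (φ : 𝓧 → 𝓥) (hφ : Measurable φ) =>
    BayesLower.bounds_le_lintegral (BayesLower.fst_jointLaw PW κ) hℓ hp hρ h hφ
  refine ⟨BayesLower.le_coe_bayesRiskDet fun φ hφ => (hjoint φ hφ).1,
    BayesLower.le_coe_bayesRiskDet fun φ hφ => (hjoint φ hφ).2, fun φ hφ => ?_⟩
  have := BayesLower.isProbabilityMeasure_estimatorLaw PW κ hφ
  rw [← BayesLower.lintegral_estimatorLaw PW κ hℓ hφ]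
  exact BayesLower.bounds_le_lintegral (BayesLower.fst_estimatorLaw PW κ hφ) hℓ hp hρ
    (h.imp_right (BayesLower.estimatorLaw_absolutelyContinuous PW κ hφ)) measurable_id
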